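/- For $n \in \mathbb{N} = \{0,1,2,\dots\}$ let $b(n)$ be the number of partitions of $n$ into parts that are powers of $2$. Let $$S_1 = \{n \in \mathbb{N} : b(n) \neq x^2+y^2+z^2 \text{ for all } x,y,z \in \mathbb{Z}\},$$ and for real $x$ let $S_1(x) = \#\{n \in S_1 : n \leq x\}$. Then for every real $x \geq 6$ we have $$-\frac{5}{3} < S_1(x) - \frac{x}{12} < \frac{1}{2}\log_2 x - \frac{19}{12}.$$ In particular, the natural density of $S_1$ in $\mathbb{N}$ exists and is equal to $$\lim_{x\to+\infty} \frac{S_1(x)}{x} = \frac{1}{12}.$$ Moreover, there exists a strictly increasing sequence $(m_l)_{l\in\mathbb{N}}$ of non-negative integers such that, as $l \to \infty$, $$S_1(m_l) - \frac{m_l}{12} \sim \frac{1}{2}\log_2 m_l,$$ i.e. the quotient of the two sides tends to $1$. -/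

import Mathlib

open Filter Topology Asymptotics

/-- The binary partition function: the number of partitions of `n` into parts that are
powers of two. -/
noncomputable def binaryPartitionCount (n : ℕ) : ℕ :=
  Nat.card {p : n.Partition // ∀ i ∈ p.parts, ∃ k : ℕ, i = 2 ^ k}

/-- The set `S₁` of all `n ∈ ℕ` such that `b(n)` is not a sum of three squares of integers. -/
def S₁ : Set ℕ :=
  {n | ¬ ∃ x y z : ℤ, (binaryPartitionCount n : ℤ) = x ^ 2 + y ^ 2 + z ^ 2}

/-- The counting function `S₁(x) = #(S₁ ∩ [0, x])` of a real variable `x`. -/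
noncomputable def S₁count (x : ℝ) : ℕ :=
  Set.ncard {n : ℕ | n ∈ S₁ ∧ (n : ℝ) ≤ x}

/-! Congruences for b modulo 32 decide membership in S₁, so only part of the three-squares theorem
is needed: 2 mod 4 and 1, 3, 5 mod 8 are sums of three squares, and 28 mod 32 is not. The positive
half follows Dirichlet: n is a value of a positive ternary form of determinant 1, found through a
prime in a progression and quadratic reciprocity, and reduction turns that form into x² + y² + z².

With t the ±1 Thue–Morse sequence, b(16p+4) ≡ 4t(p) and b(16p+12) ≡ 4t(p)+16 mod 32, b(16p+8) and
b(4q+2) are 2 mod 4, and b(16m) ≡ b(4m) mod 32 for m > 0. Hence 4q and 4q+1 lie in S₁ exactly when q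
= 4^m(4j+1) with t(j) = -1 (`four_mul_mem_S₁`), and nothing else does.

The deviation R(q) = 6·#{such numbers ≤ q} - q obeys a recursion in the base 4 digits of q. Bounds
sorted by the parity and sign of q pass through it: R ≥ -4 always, and the upper bound grows by 3
per digit. A suitable digit pattern attains that growth. -/

/-! ### Sums of three squares: reduction of ternary forms and Dirichlet's argument. -/

/-- The integer `n` is represented by a positive definite integral ternary quadratic form of
determinant `1` with leading coefficient `a` and leading `2 × 2` minor `D`. -/
def RepresentedByUnimodular (n : ℤ) (a D : ℕ) : Prop :=
  ∃ b c d e f x y z : ℤ, 0 < a ∧ 0 < D ∧ (a : ℤ) * b - f ^ 2 = D ∧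
    a * b * c + 2 * d * e * f - a * d ^ 2 - b * e ^ 2 - c * f ^ 2 = 1 ∧
    a * x ^ 2 + b * y ^ 2 + c * z ^ 2 + 2 * d * y * z + 2 * e * x * z + 2 * f * x * y = n

theorem Int.exists_add_mul_mem_Icc (f : ℤ) {a : ℤ} (ha : 0 < a) :
    ∃ k : ℤ, -a ≤ 2 * (f + k * a) ∧ 2 * (f + k * a) ≤ a := by
  refine ⟨-((2 * f + a) / (2 * a)), ?_⟩
  have h1 := Int.emod_nonneg (2 * f + a) (show 2 * a ≠ 0 by omega)
  have h2 := Int.emod_lt_of_pos (2 * f + a) (show 0 < 2 * a by omega)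
  have h3 := Int.mul_ediv_add_emod (2 * f + a) (2 * a)
  constructor <;> nlinarith

/-- Reduction with `A` minimal, then `D` minimal. Normalising `f` modulo `A` and `A * d - e * f`
modulo `D` gives 3A² ≤ 4D and 3D² ≤ 4A, which forces A = D = 1. -/
theorem RepresentedByUnimodular.exists_sq_add_sq_add_sq {n : ℤ}
    (h : ∃ a D, RepresentedByUnimodular n a D) : ∃ x y z : ℤ, n = x ^ 2 + y ^ 2 + z ^ 2 := by
  classical
  let A := Nat.find h
  have hA : ∃ D, RepresentedByUnimodular n A D := Nat.find_spec h
  have hAmin : ∀ a D, RepresentedByUnimodular n a D → A ≤ a :=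
    fun a D haD => Nat.find_min' h ⟨D, haD⟩
  let D := Nat.find hA
  have hD : RepresentedByUnimodular n A D := Nat.find_spec hA
  have hDmin : ∀ D', RepresentedByUnimodular n A D' → D ≤ D' :=
    fun D' hD' => Nat.find_min' hA hD'
  clear_value D A
  -- normalise the last two variables, then the first two
  obtain ⟨b, c, d, e, f, x, y, z, hapos, hDpos, hDeq, hdet, hrep⟩ := hD
  obtain ⟨k, hk1, hk2⟩ := Int.exists_add_mul_mem_Icc (A * d - e * f) (Int.natCast_pos.2 hDpos)
  obtain ⟨l, hl1, hl2⟩ := Int.exists_add_mul_mem_Icc f (Int.natCast_pos.2 hapos)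
  obtain ⟨b, c, d, e, f, x, y, z, hDeq, hdet, hrep, hE1, hE2, hf1, hf2⟩ :
      ∃ b c d e f x y z : ℤ, (A : ℤ) * b - f ^ 2 = D ∧
        A * b * c + 2 * d * e * f - A * d ^ 2 - b * e ^ 2 - c * f ^ 2 = 1 ∧
        A * x ^ 2 + b * y ^ 2 + c * z ^ 2 + 2 * d * y * z + 2 * e * x * z + 2 * f * x * y = n ∧
        -(D : ℤ) ≤ 2 * (A * d - e * f) ∧ 2 * (A * d - e * f) ≤ D ∧
        -(A : ℤ) ≤ 2 * f ∧ 2 * f ≤ A := by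
    -- Add `k` times the second basis vector to the third, then `l` times the first to the second;
    -- neither `A` nor `D` changes.
    refine ⟨b + 2 * l * f + l ^ 2 * A, c + 2 * k * d + k ^ 2 * b, d + k * b + l * (e + k * f),
      e + k * f, f + l * A, x - l * (y - k * z), y - k * z, z, ?_, ?_, ?_, ?_, ?_, hl1, hl2⟩
    · linear_combination hDeq
    · linear_combination hdet
    · linear_combination hrep
    · linear_combination hk1 - 2 * k * hDeq
    · linear_combination hk2 + 2 * k * hDeq
  have hAz : (0 : ℤ) < A := Int.natCast_pos.2 hapos
  have hDz : (0 : ℤ) < D := Int.natCast_pos.2 hDpos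
  have hb : 0 < b := by
    by_contra! hb
    nlinarith [sq_nonneg f, mul_nonneg hAz.le (neg_nonneg.2 hb)]
  have hab : (A : ℤ) ≤ b := by
    -- Swapping the first two variables makes `b` the leading coefficient.
    have := hAmin b.toNat D ⟨A, c, e, d, f, y, x, z, by omega, hDpos, by
      rw [Int.toNat_of_nonneg hb.le]; linear_combination hDeq, by
      rw [Int.toNat_of_nonneg hb.le]; linear_combination hdet, by
      rw [Int.toNat_of_nonneg hb.le]; linear_combination hrep⟩
    omega
  have hDF : (D : ℤ) * (A * c - e ^ 2) = A + (A * d - e * f) ^ 2 := by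
    rw [← hDeq]; linear_combination A * hdet
  have hF : 0 < (A : ℤ) * c - e ^ 2 := by
    by_contra! hF
    nlinarith [sq_nonneg ((A : ℤ) * d - e * f), mul_nonneg hDz.le (neg_nonneg.2 hF)]
  have hDleF : (D : ℤ) ≤ A * c - e ^ 2 := by
    -- Swapping the last two variables keeps `A` and makes `A * c - e ^ 2` the leading minor.
    have := hDmin ((A : ℤ) * c - e ^ 2).toNat ⟨c, b, d, f, e, x, z, y, hapos, by omega, by
      rw [Int.toNat_of_nonneg hF.le], by linear_combination hdet, by linear_combination hrep⟩
    omega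
  have h1 : 3 * (A : ℤ) ^ 2 ≤ 4 * D := by
    linear_combination 4 * A * hab + sq_le_sq' hf1 hf2 + 4 * hDeq
  have h2 : 3 * (D : ℤ) ^ 2 ≤ 4 * A := by
    linear_combination 4 * D * hDleF + sq_le_sq' hE1 hE2 + 4 * hDF
  clear hAmin hDmin hA h hk1 hk2 hl1 hl2
  have hA1 : (A : ℤ) = 1 := by
    by_contra hne
    have : (2 : ℤ) ≤ A := by omega
    nlinarith only [this, h1, h2, sq_nonneg ((A : ℤ) - 2), sq_nonneg (3 * (D : ℤ) - 2)]
  have hD1 : (D : ℤ) = 1 := by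
    by_contra hne
    have : (2 : ℤ) ≤ D := by omega
    nlinarith only [this, h1, h2, sq_nonneg ((D : ℤ) - 2), sq_nonneg (3 * (A : ℤ) - 2)]
  simp only [hA1, hD1] at hDeq hdet hrep hE1 hE2 hf1 hf2
  have hf : f = 0 := by omega
  subst hf
  have hb1 : b = 1 := by linarith
  have hd : d = 0 := by omega
  subst hb1 hd
  exact ⟨x + e * z, y, z, by linear_combination -hrep + z ^ 2 * hdet⟩

theorem exists_sq_add_sq_add_sq_of_isSquare_neg_mod {n b : ℤ} (hb : 0 < b) (hbn : 0 < b * n - 1)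
    (h : ∃ f : ℤ, b * n - 1 ∣ f ^ 2 + b) : ∃ x y z : ℤ, n = x ^ 2 + y ^ 2 + z ^ 2 := by
  obtain ⟨f, a, ha⟩ := h
  have hapos : 0 < a := by
    by_contra! h0
    nlinarith [sq_nonneg f, mul_nonneg hbn.le (neg_nonneg.2 h0)]
  -- The form has diagonal a, bn - 1, n, with `f` joining the first two variables and 1 joining the
  -- first and third. Its leading minor is `b`, its determinant nb - (bn - 1) = 1, and it takes the
  -- value `n` at (0, 0, 1).
  refine RepresentedByUnimodular.exists_sq_add_sq_add_sq ⟨a.toNat, b.toNat, b * n - 1, n, 0, 1, f,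
    0, 0, 1, by omega, by omega, ?_, ?_, by ring⟩ <;>
  simp only [Int.toNat_of_nonneg hapos.le, Int.toNat_of_nonneg hb.le]
  · linear_combination -ha
  · linear_combination -n * ha

theorem exists_prime_eq_mul_add {q a : ℕ} (hq : q ≠ 0) (h : a.Coprime q) :
    ∃ p v : ℕ, p.Prime ∧ p = q * v + a ∧ 2 < p := by
  have : NeZero q := ⟨hq⟩
  obtain ⟨p, hp, hpr, hmod⟩ := Nat.forall_exists_prime_gt_and_eq_mod
    ((ZMod.isUnit_iff_coprime a q).2 h) (a + 2)
  have h2 : a ≡ p [MOD q] := ((ZMod.natCast_eq_natCast_iff _ _ _).1 hmod).symm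
  obtain ⟨v, hv⟩ := (Nat.modEq_iff_dvd' (by omega)).1 h2
  exact ⟨p, v, hpr, by omega, by omega⟩

theorem exists_dvd_sq_add_of_jacobiSym {p : ℕ} (hp : p.Prime) {b : ℤ}
    (h : jacobiSym (-b) p = 1) : ∃ f : ℤ, (p : ℤ) ∣ f ^ 2 + b := by
  have := Fact.mk hp
  rw [← jacobiSym.legendreSym.to_jacobiSym] at h
  have hne : ((-b : ℤ) : ZMod p) ≠ 0 := by
    intro h0
    rw [(legendreSym.eq_zero_iff p (-b)).2 h0] at h
    exact zero_ne_one h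
  obtain ⟨r, hr⟩ := (legendreSym.eq_one_iff p hne).1 h
  obtain ⟨f, rfl⟩ := ZMod.intCast_surjective r
  refine ⟨f, (ZMod.intCast_zmod_eq_zero_iff_dvd _ _).1 ?_⟩
  push_cast at hr ⊢
  linear_combination -hr

theorem jacobiSym_self_mul_sub_one {b : ℕ} (hb : Odd b) (n : ℤ) :
    jacobiSym (b * n - 1) b = ZMod.χ₄ b := by
  rw [← jacobiSym.at_neg_one hb]
  exact jacobiSym.mod_left' (Int.modEq_iff_dvd.2 ⟨-n, by ring⟩)

/-- Take b = 4v + 1 with p = bn - 1 prime. Since p ≡ 1 mod 4, (-b/p) = (b/p) = (p/b) = (-1/b) = 1.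
-/
theorem exists_sq_add_sq_add_sq_of_mod_four_eq_two {n : ℕ} (hn : n % 4 = 2) :
    ∃ x y z : ℤ, (n : ℤ) = x ^ 2 + y ^ 2 + z ^ 2 := by
  have hcop : (n - 1).Coprime (4 * n) := by
    refine Nat.Coprime.mul_right ?_ ?_
    · exact Nat.Coprime.pow_right 2 ((Nat.coprime_two_right).2 (Nat.odd_iff.2 (by omega)))
    · rw [show n = n - 1 + 1 by omega]
      simp
  obtain ⟨p, v, hp, hpv, hp2⟩ := exists_prime_eq_mul_add (by omega) hcop
  have hbn : ((4 * v + 1 : ℕ) : ℤ) * n - 1 = p := by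
    have : (4 * v + 1) * n = p + 1 := by
      rw [hpv]; ring_nf; omega
    zify at this; push_cast; linarith
  have hp4 : p % 4 = 1 := by
    rw [hpv, mul_assoc]; omega
  refine exists_sq_add_sq_add_sq_of_isSquare_neg_mod (b := (4 * v + 1 : ℕ)) (by positivity)
    (by rw [hbn]; exact_mod_cast hp.pos) ?_
  rw [hbn]
  apply exists_dvd_sq_add_of_jacobiSym hp
  have hb : Odd (4 * v + 1) := ⟨2 * v, by ring⟩
  have hpo : Odd p := Nat.odd_iff.2 (by omega)
  rw [jacobiSym.neg _ hpo, ZMod.χ₄_nat_one_mod_four hp4, one_mul,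
    jacobiSym.quadratic_reciprocity_one_mod_four' hb hp4, ← hbn,
    jacobiSym_self_mul_sub_one hb, ZMod.χ₄_nat_one_mod_four (by omega)]

/-- Here bn - 1 is even, so it is made twice an odd prime p, with b ≡ c mod 8. The choice of c fixes
(2/b), and (2p/b) = (-1/b) then yields (-b/p) = 1. -/
theorem exists_sq_add_sq_add_sq_of_mod_eight {n : ℕ} (hn : n % 8 = 1 ∨ n % 8 = 3 ∨ n % 8 = 5) :
    ∃ x y z : ℤ, (n : ℤ) = x ^ 2 + y ^ 2 + z ^ 2 := by
  obtain ⟨c, a, hc, ha, hodd⟩ : ∃ c a : ℕ, (n % 8 = 3 ∧ c = 1 ∨ n % 4 = 1 ∧ c = 3) ∧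
      2 * a + 1 = c * n ∧ a % 2 = 1 := by
    rcases (by omega : n % 8 = 3 ∨ n % 4 = 1) with h | h
    · exact ⟨1, (n - 1) / 2, by omega, by omega, by omega⟩
    · exact ⟨3, (3 * n - 1) / 2, by omega, by omega, by omega⟩
  have hcop : a.Coprime (4 * n) := by
    refine Nat.Coprime.mul_right ?_ ?_
    · exact Nat.Coprime.pow_right 2 ((Nat.coprime_two_right).2 (Nat.odd_iff.2 hodd))
    · have : a.Coprime (2 * a + 1) := by simp
      rw [ha] at this
      exact this.coprime_mul_left_right
  obtain ⟨p, v, hp, hpv, hp2⟩ := exists_prime_eq_mul_add (by omega) hcop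
  set b := 8 * v + c with hbdef
  have hbn : (b : ℤ) * n - 1 = 2 * p := by
    have : b * n = 2 * p + 1 := by
      rw [hpv, hbdef, add_mul, ← ha]; ring
    zify at this; linarith
  have hb : Odd b := Nat.odd_iff.2 (by omega)
  have hpo : Odd p := hp.odd_of_ne_two (by omega)
  have hneg1 : jacobiSym (2 * p : ℤ) b = ZMod.χ₄ b := by
    rw [← hbn, jacobiSym_self_mul_sub_one hb]
  rw [jacobiSym.mul_left, jacobiSym.at_two hb] at hneg1
  have hjac : jacobiSym (-(b : ℤ)) p = 1 := by
    rw [jacobiSym.neg _ hpo]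
    have hpv' : p = 4 * (n * v) + a := by rw [hpv]; ring
    rcases hc with ⟨h3, rfl⟩ | ⟨h1, rfl⟩
    · have hp4 : p % 4 = 1 := by omega
      have hχ : ZMod.χ₈ (b : ZMod 8) = 1 := by
        rw [ZMod.χ₈_nat_eq_if_mod_eight]; simp [show b % 2 = 1 by omega, show b % 8 = 1 by omega]
      rw [hχ, one_mul, ZMod.χ₄_nat_one_mod_four (by omega : b % 4 = 1)] at hneg1
      rw [ZMod.χ₄_nat_one_mod_four hp4, one_mul,
        jacobiSym.quadratic_reciprocity_one_mod_four' hb hp4, hneg1]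
    · have hχ : ZMod.χ₈ (b : ZMod 8) = -1 := by
        rw [ZMod.χ₈_nat_eq_if_mod_eight]; simp [show b % 2 = 1 by omega, show b % 8 = 3 by omega]
      rw [hχ, ZMod.χ₄_nat_three_mod_four (by omega : b % 4 = 3)] at hneg1
      rcases (by omega : p % 4 = 1 ∨ p % 4 = 3) with hp4 | hp4
      · rw [ZMod.χ₄_nat_one_mod_four hp4, one_mul,
          jacobiSym.quadratic_reciprocity_one_mod_four' hb hp4]
        linarith
      · rw [ZMod.χ₄_nat_three_mod_four hp4,
          jacobiSym.quadratic_reciprocity_three_mod_four (by omega) hp4]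
        linarith
  refine exists_sq_add_sq_add_sq_of_isSquare_neg_mod (b := b) (by omega)
    (by rw [hbn]; have := hp.pos; positivity) ?_
  rw [hbn]
  obtain ⟨f, hf⟩ := exists_dvd_sq_add_of_jacobiSym hp hjac
  -- As `b` is odd, an odd root modulo `p` is also a root modulo 2; adding `p` corrects the parity.
  obtain ⟨g, hg, hgodd⟩ : ∃ g : ℤ, (p : ℤ) ∣ g ^ 2 + b ∧ Odd g := by
    rcases Int.even_or_odd f with h | h
    · refine ⟨f + p, ?_, h.add_odd (by exact_mod_cast hpo)⟩
      have : (f + p) ^ 2 + (b : ℤ) = (f ^ 2 + b) + p * (2 * f + p) := by ring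
      rw [this]
      exact dvd_add hf (dvd_mul_right _ _)
    · exact ⟨f, hf, h⟩
  refine ⟨g, IsCoprime.mul_dvd ?_ ?_ hg⟩
  · exact (Int.isCoprime_iff_gcd_eq_one.2 (by
      simpa [Int.gcd] using (Nat.coprime_two_left).2 hpo))
  · exact even_iff_two_dvd.1 ((hgodd.pow).add_odd (by exact_mod_cast hb))

/-! ### Recurrences for the binary partition function. -/

/-- The multisets of powers of two with sum `n`. -/
def binaryMultisets (n : ℕ) : Set (Multiset ℕ) :=
  {s | (∀ i ∈ s, ∃ k : ℕ, i = 2 ^ k) ∧ s.sum = n}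

theorem binaryPartitionCount_eq_ncard (n : ℕ) :
    binaryPartitionCount n = (binaryMultisets n).ncard := by
  rw [binaryPartitionCount, ← Nat.card_coe_set_eq]
  refine Nat.card_congr ⟨fun p => ⟨p.1.parts, p.2, p.1.parts_sum⟩,
    fun s => ⟨⟨s.1, fun {i} hi => ?_, s.2.2⟩, s.2.1⟩, fun p => rfl, fun s => rfl⟩
  obtain ⟨k, rfl⟩ := s.2.1 i hi
  positivity

theorem finite_binaryMultisets (n : ℕ) : (binaryMultisets n).Finite := by
  refine (Set.finite_range (fun p : n.Partition => p.parts)).subset ?_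
  intro s hs
  refine ⟨⟨s, fun {i} hi => ?_, hs.2⟩, rfl⟩
  obtain ⟨k, rfl⟩ := hs.1 i hi
  positivity

theorem binaryMultisets_succ_with_one (n : ℕ) :
    {s ∈ binaryMultisets (n + 1) | 1 ∈ s} = (fun s => 1 ::ₘ s) '' binaryMultisets n := by
  ext s
  constructor
  · rintro ⟨⟨h1, h2⟩, h3⟩
    obtain ⟨t, rfl⟩ := Multiset.exists_cons_of_mem h3
    refine ⟨t, ⟨fun i hi => h1 i (Multiset.mem_cons_of_mem hi), ?_⟩, rfl⟩
    rw [Multiset.sum_cons] at h2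
    omega
  · rintro ⟨t, ⟨h1, h2⟩, rfl⟩
    refine ⟨⟨fun i hi => ?_, by rw [Multiset.sum_cons, h2, add_comm]⟩, Multiset.mem_cons_self _ _⟩
    rcases Multiset.mem_cons.1 hi with rfl | hi
    · exact ⟨0, rfl⟩
    · exact h1 i hi

theorem even_of_mem_binaryMultisets {n : ℕ} {s : Multiset ℕ} (hs : s ∈ binaryMultisets n)
    (h : 1 ∉ s) : s = (s.map (· / 2)).map (2 * ·) ∧ ∀ i ∈ s.map (· / 2), ∃ k : ℕ, i = 2 ^ k := by
  have key : ∀ i ∈ s, ∃ k : ℕ, i = 2 * 2 ^ k := by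
    intro i hi
    obtain ⟨k, rfl⟩ := hs.1 i hi
    cases k with
    | zero => exact absurd hi h
    | succ k => exact ⟨k, pow_succ' 2 k⟩
  constructor
  · rw [Multiset.map_map]
    conv_lhs => rw [← Multiset.map_id s]
    refine Multiset.map_congr rfl fun i hi => ?_
    obtain ⟨k, rfl⟩ := key i hi
    simp
  · intro i hi
    obtain ⟨j, hj, rfl⟩ := Multiset.mem_map.1 hi
    obtain ⟨k, rfl⟩ := key j hj
    exact ⟨k, by simp⟩

theorem binaryMultisets_two_mul_without_one (n : ℕ) :
    {s ∈ binaryMultisets (2 * n) | 1 ∉ s} = (fun s => s.map (2 * ·)) '' binaryMultisets n := by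
  ext s
  constructor
  · rintro ⟨hs, h⟩
    obtain ⟨h1, h2⟩ := even_of_mem_binaryMultisets hs h
    refine ⟨s.map (· / 2), ⟨h2, ?_⟩, h1.symm⟩
    have := hs.2
    rw [h1, Multiset.sum_map_mul_left, Multiset.map_id'] at this
    omega
  · rintro ⟨t, ⟨h1, h2⟩, rfl⟩
    refine ⟨⟨fun i hi => ?_, by rw [Multiset.sum_map_mul_left, Multiset.map_id', h2]⟩, fun h => ?_⟩
    · obtain ⟨j, hj, rfl⟩ := Multiset.mem_map.1 hi
      obtain ⟨k, rfl⟩ := h1 j hj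
      exact ⟨k + 1, (pow_succ' 2 k).symm⟩
    · obtain ⟨j, _, hj⟩ := Multiset.mem_map.1 h
      omega

theorem binaryMultisets_odd_without_one (n : ℕ) :
    {s ∈ binaryMultisets (2 * n + 1) | 1 ∉ s} = ∅ := by
  rw [Set.eq_empty_iff_forall_notMem]
  rintro s ⟨hs, h⟩
  obtain ⟨h1, -⟩ := even_of_mem_binaryMultisets hs h
  have := hs.2
  rw [h1, Multiset.sum_map_mul_left] at this
  omega

theorem binaryPartitionCount_succ (n : ℕ) :
    binaryPartitionCount (n + 1) =
      binaryPartitionCount n + {s ∈ binaryMultisets (n + 1) | 1 ∉ s}.ncard := by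
  rw [binaryPartitionCount_eq_ncard, binaryPartitionCount_eq_ncard,
    ← Set.ncard_image_of_injective (binaryMultisets n) (f := fun s => 1 ::ₘ s)
      (fun s t h => (Multiset.cons_inj_right 1).1 h),
    ← binaryMultisets_succ_with_one, ← Set.ncard_union_eq
      (Set.disjoint_left.2 fun s h1 h2 => h2.2 h1.2)
      ((finite_binaryMultisets _).subset fun s h => h.1)
      ((finite_binaryMultisets _).subset fun s h => h.1)]
  congr 1
  ext s
  simp only [Set.mem_union, Set.mem_ofPred_eq]
  tauto

theorem binaryPartitionCount_zero : binaryPartitionCount 0 = 1 := by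
  rw [binaryPartitionCount_eq_ncard, Set.ncard_eq_one]
  refine ⟨0, ?_⟩
  ext s
  constructor
  · rintro ⟨h1, h2⟩
    refine Multiset.eq_zero_of_forall_notMem fun i hi => ?_
    obtain ⟨k, rfl⟩ := h1 i hi
    have := (Multiset.sum_eq_zero_iff.1 h2) _ hi
    exact absurd this (by positivity)
  · rintro rfl
    exact ⟨by simp, by simp⟩

theorem binaryPartitionCount_two_mul_add_one (n : ℕ) :
    binaryPartitionCount (2 * n + 1) = binaryPartitionCount (2 * n) := by
  rw [binaryPartitionCount_succ, binaryMultisets_odd_without_one, Set.ncard_empty, add_zero]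

theorem binaryPartitionCount_two_mul_add_two (n : ℕ) :
    binaryPartitionCount (2 * n + 2) =
      binaryPartitionCount (2 * n) + binaryPartitionCount (n + 1) := by
  rw [binaryPartitionCount_succ, binaryPartitionCount_two_mul_add_one,
    show 2 * n + 1 + 1 = 2 * (n + 1) by ring, binaryMultisets_two_mul_without_one,
    Set.ncard_image_of_injective _ (Multiset.map_injective fun a b h => by simpa using h),
    ← binaryPartitionCount_eq_ncard]

/-! ### Thue–Morse signs and b modulo 8. -/

/-- The Thue–Morse sequence with values `±1`. -/
def thueMorseSign (n : ℕ) : ℤ := (-1) ^ (Nat.digits 2 n).sum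

theorem thueMorseSign_zero : thueMorseSign 0 = 1 := by simp [thueMorseSign]

theorem thueMorseSign_two_mul_add_one (n : ℕ) :
    thueMorseSign (2 * n + 1) = -thueMorseSign n := by
  rw [thueMorseSign, Nat.digits_def' (by norm_num) (by omega),
    show (2 * n + 1) % 2 = 1 by omega, show (2 * n + 1) / 2 = n by omega, List.sum_cons, pow_add,
    thueMorseSign]
  ring

theorem thueMorseSign_two_mul (n : ℕ) : thueMorseSign (2 * n) = thueMorseSign n := by
  rcases Nat.eq_zero_or_pos n with rfl | h
  · rfl
  rw [thueMorseSign, Nat.digits_def' (by norm_num) (by omega),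
    show (2 * n) % 2 = 0 by omega, show (2 * n) / 2 = n by omega, List.sum_cons, zero_add,
    thueMorseSign]

theorem thueMorseSign_eq_or (n : ℕ) : thueMorseSign n = 1 ∨ thueMorseSign n = -1 :=
  neg_one_pow_eq_or ℤ _

/-- If B is the generating function of b, then 1/B is that of t, so this says that B and (1-x)²/B
agree modulo 8 from degree 2 on. In the induction the two sides of the recurrence differ by 4 times
a difference of two signs, a multiple of 8. -/
theorem binaryPartitionCount_add_two_mod (n : ℕ) : ((binaryPartitionCount (n + 2) : ℤ) -
    (thueMorseSign (n + 2) - 2 * thueMorseSign (n + 1) + thueMorseSign n)) % 8 = 0 := by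
  induction n using Nat.strong_induction_on with
  | _ n ih =>
    have t1 : thueMorseSign 1 = -1 := by
      have := thueMorseSign_two_mul_add_one 0
      rwa [thueMorseSign_zero] at this
    have t2 : thueMorseSign 2 = -1 := by rw [← t1]; exact thueMorseSign_two_mul 1
    have t3 : thueMorseSign 3 = 1 := by
      rw [show 3 = 2 * 1 + 1 by rfl, thueMorseSign_two_mul_add_one, t1]; rfl
    have t4 : thueMorseSign 4 = -1 := by rw [← t2]; exact thueMorseSign_two_mul 2
    have b1 : binaryPartitionCount 1 = 1 := by
      exact (binaryPartitionCount_two_mul_add_one 0).trans binaryPartitionCount_zero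
    have b2 : binaryPartitionCount 2 = 2 := by
      have := binaryPartitionCount_two_mul_add_two 0
      simpa [binaryPartitionCount_zero, b1] using this
    have b4 : binaryPartitionCount 4 = 4 := by
      have := binaryPartitionCount_two_mul_add_two 1
      simpa [b2] using this
    have heven : ∀ m, 2 * m ≤ n → ((binaryPartitionCount (2 * m + 2) : ℤ) -
        (thueMorseSign (2 * m + 2) - 2 * thueMorseSign (2 * m + 1) + thueMorseSign (2 * m))) % 8
          = 0 := by
      intro m hm
      match m with
      | 0 => simp [b2, t2, t1, thueMorseSign_zero]
      | 1 => simp [b4, t2, t3, t4]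
      | m + 2 =>
        have h1 := ih (2 * m + 2) (by omega)
        have h2 := ih (m + 1) (by omega)
        have r := binaryPartitionCount_two_mul_add_two (m + 2)
        have e1 := thueMorseSign_two_mul (m + 1)
        have e2 := thueMorseSign_two_mul (m + 2)
        have e3 := thueMorseSign_two_mul (m + 3)
        have e4 := thueMorseSign_two_mul_add_one (m + 1)
        have e5 := thueMorseSign_two_mul_add_one (m + 2)
        simp only [mul_add, mul_one, Nat.reduceMul, add_assoc, Nat.reduceAdd] at *
        have o1 := thueMorseSign_eq_or (m + 1)
        have o2 := thueMorseSign_eq_or (m + 2)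
        omega
    rcases Nat.even_or_odd' n with ⟨m, rfl | rfl⟩
    · exact heven m le_rfl
    · have h := heven m (by omega)
      have r := binaryPartitionCount_two_mul_add_one (m + 1)
      have e1 := thueMorseSign_two_mul m
      have e2 := thueMorseSign_two_mul (m + 1)
      have e3 := thueMorseSign_two_mul_add_one m
      have e4 := thueMorseSign_two_mul_add_one (m + 1)
      simp only [mul_add, mul_one, add_assoc, Nat.reduceAdd] at *
      have o1 := thueMorseSign_eq_or m
      have o2 := thueMorseSign_eq_or (m + 1)
      omega

/-! ### Iterated partial sums and b modulo 32. -/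

/-- Partial sums of the binary partition function at even arguments. -/
noncomputable def binarySumE (n : ℕ) : ℤ :=
  ∑ i ∈ Finset.range n, (binaryPartitionCount (2 * i) : ℤ)

/-- Second iterated partial sums of the binary partition function at even arguments. -/
noncomputable def binarySumF (n : ℕ) : ℤ := ∑ i ∈ Finset.range n, binarySumE (i + 1)

/-- Third iterated partial sums of the binary partition function at even arguments. -/
noncomputable def binarySumG (n : ℕ) : ℤ := ∑ i ∈ Finset.range n, binarySumF (i + 1)

theorem binarySumE_succ (n : ℕ) :
    binarySumE (n + 1) = binarySumE n + binaryPartitionCount (2 * n) := Finset.sum_range_succ _ _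

theorem binarySumF_succ (n : ℕ) : binarySumF (n + 1) = binarySumF n + binarySumE (n + 1) :=
  Finset.sum_range_succ _ _

theorem binarySumG_succ (n : ℕ) : binarySumG (n + 1) = binarySumG n + binarySumF (n + 1) :=
  Finset.sum_range_succ _ _

theorem binarySumE_zero : binarySumE 0 = 0 := rfl
theorem binarySumF_zero : binarySumF 0 = 0 := rfl
theorem binarySumG_zero : binarySumG 0 = 0 := rfl

/-- The series C of b(2i) satisfies C(y) = (1+y)²/(1-y²)·C(y²). Dividing by further powers of 1 - y
raises the exponent of 1 + y, so the coefficients in this and the next dissections are binomial: 1,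
2, 1, then 1, 3, 3, 1, then 1, 4, 6, 4, 1. -/
theorem binaryPartitionCount_four_mul (n : ℕ) :
    (binaryPartitionCount (4 * n) : ℤ) = binarySumE (n + 1) + binarySumE n ∧
    (binaryPartitionCount (4 * n + 2) : ℤ) = 2 * binarySumE (n + 1) := by
  induction n with
  | zero =>
    have r := binaryPartitionCount_two_mul_add_two 0
    have r1 := binaryPartitionCount_two_mul_add_one 0
    have h1 := binarySumE_succ 0
    have h0 := binarySumE_zero
    simp only [mul_zero, zero_add] at *
    omega
  | succ n ih =>
    have r1 := binaryPartitionCount_two_mul_add_two (2 * n + 1)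
    have r2 := binaryPartitionCount_two_mul_add_two (2 * n + 2)
    have r3 := binaryPartitionCount_two_mul_add_one (n + 1)
    have h1 := binarySumE_succ (n + 1)
    simp only [mul_add, mul_one, Nat.reduceMul, add_assoc, Nat.reduceAdd, ← mul_assoc] at *
    omega

theorem binarySumE_two_mul_add (n : ℕ) :
    binarySumE (2 * n + 1) = binarySumF (n + 1) + 3 * binarySumF n ∧
    binarySumE (2 * n + 2) = 3 * binarySumF (n + 1) + binarySumF n := by
  induction n with
  | zero =>
    have h1 := binarySumE_succ 1
    have h2 := binarySumF_succ 0
    have h3 := (binaryPartitionCount_four_mul 0).2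
    simp only [binarySumF_zero, mul_zero, zero_add, mul_one, Nat.reduceAdd] at *
    omega
  | succ n ih =>
    have h1 := binarySumE_succ (2 * n + 2)
    have h2 := binarySumE_succ (2 * n + 3)
    have h3 := binarySumF_succ n
    have h4 := binarySumF_succ (n + 1)
    obtain ⟨h5, h6⟩ := binaryPartitionCount_four_mul (n + 1)
    simp only [mul_add, mul_one, Nat.reduceMul, add_assoc, Nat.reduceAdd, ← mul_assoc] at *
    omega

theorem binaryPartitionCount_eight_mul_add_four (k : ℕ) :
    (binaryPartitionCount (8 * k + 4) : ℤ) = 4 * (binarySumF (k + 1) + binarySumF k) := by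
  have h1 := (binaryPartitionCount_four_mul (2 * k + 1)).1
  have h2 := binarySumE_two_mul_add k
  simp only [mul_add, mul_one, add_assoc, Nat.reduceAdd, ← mul_assoc, Nat.reduceMul] at *
  omega

theorem binaryPartitionCount_eight_mul (k : ℕ) :
    (binaryPartitionCount (8 * k + 8) : ℤ) =
      binarySumF (k + 2) + 6 * binarySumF (k + 1) + binarySumF k ∧
    (binaryPartitionCount (8 * k + 8) : ℤ) =
      binaryPartitionCount (2 * k + 2) + 8 * binarySumF (k + 1) := by
  have h1 := (binaryPartitionCount_four_mul (2 * k + 2)).1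
  have h2 := binarySumE_two_mul_add k
  have h3 := binarySumE_two_mul_add (k + 1)
  have h4 := binarySumE_succ (k + 1)
  have h5 := binarySumF_succ k
  have h6 := binarySumF_succ (k + 1)
  simp only [mul_add, mul_one, add_assoc, Nat.reduceAdd, ← mul_assoc, Nat.reduceMul] at *
  omega

theorem binarySumF_two_mul_add_two (n : ℕ) :
    binarySumF (2 * n + 2) = 4 * (binarySumG (n + 1) + binarySumG n) := by
  induction n with
  | zero =>
    have h1 := binarySumF_succ 0
    have h2 := binarySumF_succ 1
    have h3 := binarySumE_two_mul_add 0
    have h4 := binarySumG_succ 0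
    simp only [binarySumF_zero, binarySumG_zero, mul_zero, zero_add, Nat.reduceAdd] at *
    omega
  | succ n ih =>
    have h1 := binarySumF_succ (2 * n + 2)
    have h2 := binarySumF_succ (2 * n + 3)
    have h3 := binarySumE_two_mul_add (n + 1)
    have h4 := binarySumG_succ n
    have h5 := binarySumG_succ (n + 1)
    simp only [mul_add, mul_one, add_assoc, Nat.reduceAdd] at *
    omega

/-- Modulo 32 this makes b(4q) invariant under q ↦ 4q. The factor 32 is the 8 of
`binaryPartitionCount_eight_mul` times the 4 of `binarySumF_two_mul_add_two`. -/
theorem binaryPartitionCount_sixteen_mul (k : ℕ) :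
    (binaryPartitionCount (16 * k + 16) : ℤ) =
      binaryPartitionCount (4 * k + 4) + 32 * (binarySumG (k + 1) + binarySumG k) := by
  have h1 := (binaryPartitionCount_eight_mul (2 * k + 1)).1
  have h2 := (binaryPartitionCount_four_mul (k + 1)).1
  have h3 := binarySumF_two_mul_add_two k
  have h4 := binarySumF_succ (2 * k + 1)
  have h5 := binarySumF_succ (2 * k + 2)
  have h6 := binarySumE_two_mul_add k
  have h7 := binarySumE_two_mul_add (k + 1)
  have h8 := binarySumF_succ k
  have h9 := binarySumF_succ (k + 1)
  have h10 := binarySumG_succ k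
  simp only [mul_add, mul_one, add_assoc, Nat.reduceAdd, ← mul_assoc, Nat.reduceMul] at *
  omega

theorem binarySumE_succ_mod (n : ℕ) :
    (binarySumE (n + 1) - (thueMorseSign n + 4 * n)) % 8 = 0 := by
  induction n with
  | zero =>
    have h1 := binarySumE_succ 0
    simp only [mul_zero, binaryPartitionCount_zero, binarySumE_zero] at h1
    rw [h1, thueMorseSign_zero]
    norm_num
  | succ n ih =>
    have h1 := binarySumE_succ (n + 1)
    have h2 := binaryPartitionCount_add_two_mod (2 * n)
    have e1 := thueMorseSign_two_mul n
    have e2 := thueMorseSign_two_mul (n + 1)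
    have e3 := thueMorseSign_two_mul_add_one n
    have o1 := thueMorseSign_eq_or n
    simp only [mul_add, mul_one] at *
    push_cast
    omega

theorem binarySumF_add_mod (n : ℕ) :
    (binarySumF (2 * n + 1) + binarySumF (2 * n) - thueMorseSign n) % 8 = 0 ∧
    (binarySumF (2 * n + 2) + binarySumF (2 * n + 1) - (thueMorseSign n + 4)) % 8 = 0 := by
  have step : ∀ m, (binarySumF (2 * m + 1) + binarySumF (2 * m) - thueMorseSign m) % 8 = 0 →
      (binarySumF (2 * m + 2) + binarySumF (2 * m + 1) - (thueMorseSign m + 4)) % 8 = 0 := by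
    intro m hm
    have h1 := binarySumF_succ (2 * m)
    have h2 := binarySumF_succ (2 * m + 1)
    have h3 := binarySumE_succ_mod (2 * m)
    have h4 := binarySumE_succ_mod (2 * m + 1)
    have e1 := thueMorseSign_two_mul m
    have e3 := thueMorseSign_two_mul_add_one m
    simp only [add_assoc, Nat.reduceAdd] at *
    push_cast at *
    omega
  have first : (binarySumF (2 * n + 1) + binarySumF (2 * n) - thueMorseSign n) % 8 = 0 := by
    induction n with
    | zero =>
      have h1 := binarySumF_succ 0
      have h2 := binarySumE_succ_mod 0
      simp only [binarySumF_zero, mul_zero, zero_add, Nat.cast_zero] at *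
      omega
    | succ n ih =>
      have ih' := step n ih
      have h1 := binarySumF_succ (2 * n + 1)
      have h2 := binarySumF_succ (2 * n + 2)
      have h3 := binarySumE_succ_mod (2 * n + 1)
      have h4 := binarySumE_succ_mod (2 * n + 2)
      have e1 := thueMorseSign_two_mul (n + 1)
      have e3 := thueMorseSign_two_mul_add_one n
      simp only [mul_add, mul_one, add_assoc, Nat.reduceAdd] at *
      push_cast at *
      omega
  exact ⟨first, step n first⟩

/-! ### Determination of S₁. -/

theorem exists_sq_add_sq_add_sq_of_div_four {n : ℕ} (hn : n % 4 = 0)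
    (h : n / 4 % 8 = 1 ∨ n / 4 % 8 = 3 ∨ n / 4 % 8 = 5) :
    ∃ x y z : ℤ, (n : ℤ) = x ^ 2 + y ^ 2 + z ^ 2 := by
  obtain ⟨x, y, z, hxyz⟩ := exists_sq_add_sq_add_sq_of_mod_eight h
  refine ⟨2 * x, 2 * y, 2 * z, ?_⟩
  have : (n : ℤ) = 4 * (n / 4 : ℕ) := by omega
  rw [this, hxyz]
  ring

theorem not_exists_sq_add_sq_add_sq {n : ℕ} (hn : n % 32 = 28) :
    ¬ ∃ x y z : ℤ, (n : ℤ) = x ^ 2 + y ^ 2 + z ^ 2 := by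
  rintro ⟨x, y, z, h⟩
  have hsq : ∀ w : ℤ, w ^ 2 % 8 = 0 ∨ w ^ 2 % 8 = 1 ∨ w ^ 2 % 8 = 4 := by
    intro w
    rcases Int.even_or_odd' w with ⟨k, rfl | rfl⟩
    · have : (2 * k) ^ 2 = 4 * k ^ 2 := by ring
      omega
    · obtain ⟨r, hr⟩ := Int.even_mul_succ_self k
      have : (2 * k + 1) ^ 2 = 8 * r + 1 := by linear_combination 4 * hr
      omega
  have heven : ∀ w : ℤ, w ^ 2 % 8 = 1 ∨ ∃ u, w ^ 2 = 4 * u ^ 2 := by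
    intro w
    rcases Int.even_or_odd' w with ⟨k, rfl | rfl⟩
    · exact Or.inr ⟨k, by ring⟩
    · obtain ⟨r, hr⟩ := Int.even_mul_succ_self k
      have : (2 * k + 1) ^ 2 = 8 * r + 1 := by linear_combination 4 * hr
      omega
  have hx := hsq x
  have hy := hsq y
  have hz := hsq z
  -- A multiple of 4 needs three even squares; dividing by 4 leaves 7 mod 8, which three squares
  -- never reach.
  obtain hx' | ⟨a, ha⟩ := heven x
  · omega
  obtain hy' | ⟨b, hb⟩ := heven y
  · omega
  obtain hz' | ⟨c, hc⟩ := heven z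
  · omega
  have ha' := hsq a
  have hb' := hsq b
  have hc' := hsq c
  omega

/-- The numbers `4 ^ m * (4 * j + 1)` where `j` has an odd number of binary digits `1`. -/
def oddThueMorseSet : Set ℕ := {q | ∃ m j : ℕ, q = 4 ^ m * (4 * j + 1) ∧ thueMorseSign j = -1}

theorem four_mul_mem_oddThueMorseSet {q : ℕ} : 4 * q ∈ oddThueMorseSet ↔ q ∈ oddThueMorseSet := by
  constructor
  · rintro ⟨m, j, h, hj⟩
    cases m with
    | zero => omega
    | succ m => exact ⟨m, j, by rw [pow_succ', mul_assoc] at h; omega, hj⟩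
  · rintro ⟨m, j, h, hj⟩
    exact ⟨m + 1, j, by rw [h]; ring, hj⟩

theorem mem_oddThueMorseSet_of_not_dvd {q : ℕ} (hq : q % 4 ≠ 0) :
    q ∈ oddThueMorseSet ↔ q % 4 = 1 ∧ thueMorseSign (q / 4) = -1 := by
  constructor
  · rintro ⟨m, j, h, hj⟩
    cases m with
    | zero =>
      rw [pow_zero, one_mul] at h
      exact ⟨by omega, by rwa [show q / 4 = j by omega]⟩
    | succ m =>
      rw [pow_succ', mul_assoc] at h
      omega
  · rintro ⟨h, hj⟩
    exact ⟨0, q / 4, by omega, hj⟩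

theorem zero_notMem_oddThueMorseSet : 0 ∉ oddThueMorseSet := by
  rintro ⟨m, j, h, -⟩
  have : 0 < 4 ^ m * (4 * j + 1) := by positivity
  omega

theorem binaryPartitionCount_four_mul_mod (q : ℕ) :
    (q ∈ oddThueMorseSet → binaryPartitionCount (4 * q) % 32 = 28) ∧
    (q ∉ oddThueMorseSet → q ≠ 0 → binaryPartitionCount (4 * q) % 4 = 2 ∨
      binaryPartitionCount (4 * q) % 32 = 4 ∨ binaryPartitionCount (4 * q) % 32 = 12 ∨
      binaryPartitionCount (4 * q) % 32 = 20) := by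
  induction q using Nat.strong_induction_on with
  | _ q ih =>
    obtain ⟨p, rfl | rfl | rfl | rfl⟩ : ∃ p, q = 4 * p ∨ q = 4 * p + 1 ∨ q = 4 * p + 2 ∨
      q = 4 * p + 3 := ⟨q / 4, by omega⟩
    · rcases p with _ | p
      · simp [zero_notMem_oddThueMorseSet]
      · have h := ih (p + 1) (by omega)
        rw [four_mul_mem_oddThueMorseSet]
        have hb := binaryPartitionCount_sixteen_mul p
        simp only [mul_add, mul_one, ← mul_assoc, Nat.reduceMul] at *
        refine ⟨fun hp => ?_, fun hp _ => ?_⟩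
        · have := h.1 hp
          omega
        · have := h.2 hp (by omega)
          omega
    · rw [mem_oddThueMorseSet_of_not_dvd (by omega), show (4 * p + 1) / 4 = p by omega]
      have hb := binaryPartitionCount_eight_mul_add_four (2 * p)
      have hm := (binarySumF_add_mod p).1
      have ht := thueMorseSign_eq_or p
      simp only [mul_add, mul_one, ← mul_assoc, Nat.reduceMul] at *
      omega
    · rw [mem_oddThueMorseSet_of_not_dvd (by omega)]
      have hb := (binaryPartitionCount_eight_mul (2 * p)).2
      have hb' := (binaryPartitionCount_four_mul p).2
      have hm := binarySumE_succ_mod p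
      have ht := thueMorseSign_eq_or p
      simp only [mul_add, ← mul_assoc, Nat.reduceMul] at *
      omega
    · rw [mem_oddThueMorseSet_of_not_dvd (by omega)]
      have hb := binaryPartitionCount_eight_mul_add_four (2 * p + 1)
      have hm := (binarySumF_add_mod p).2
      have ht := thueMorseSign_eq_or p
      simp only [mul_add, mul_one, ← mul_assoc, Nat.reduceMul, add_assoc, Nat.reduceAdd] at *
      omega

theorem four_mul_mem_S₁ (q : ℕ) : 4 * q ∈ S₁ ↔ q ∈ oddThueMorseSet := by
  obtain ⟨h1, h2⟩ := binaryPartitionCount_four_mul_mod q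
  constructor
  · intro h
    by_contra hq
    refine h ?_
    rcases Nat.eq_zero_or_pos q with rfl | hpos
    · exact ⟨1, 0, 0, by simp [binaryPartitionCount_zero]⟩
    · rcases h2 hq hpos.ne' with h | h
      · exact exists_sq_add_sq_add_sq_of_mod_four_eq_two h
      · exact exists_sq_add_sq_add_sq_of_div_four (by omega) (by omega)
  · exact fun hq => not_exists_sq_add_sq_add_sq (h1 hq)

theorem four_mul_add_two_notMem_S₁ (q : ℕ) : 4 * q + 2 ∉ S₁ := by
  refine fun h => h (exists_sq_add_sq_add_sq_of_mod_four_eq_two ?_)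
  have hb' := (binaryPartitionCount_four_mul q).2
  have hm := binarySumE_succ_mod q
  have ht := thueMorseSign_eq_or q
  omega

theorem two_mul_add_one_mem_S₁ (n : ℕ) : 2 * n + 1 ∈ S₁ ↔ 2 * n ∈ S₁ := by
  simp only [S₁, Set.mem_ofPred_eq, binaryPartitionCount_two_mul_add_one]

theorem four_mul_add_one_mem_S₁ (q : ℕ) : 4 * q + 1 ∈ S₁ ↔ q ∈ oddThueMorseSet := by
  rw [← four_mul_mem_S₁, show 4 * q = 2 * (2 * q) by ring, two_mul_add_one_mem_S₁]

theorem four_mul_add_three_notMem_S₁ (q : ℕ) : 4 * q + 3 ∉ S₁ := by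
  rw [show 4 * q + 3 = 2 * (2 * q + 1) + 1 by ring, two_mul_add_one_mem_S₁,
    show 2 * (2 * q + 1) = 4 * q + 2 by ring]
  exact four_mul_add_two_notMem_S₁ q

/-! ### Counting function and its deviation from the linear term. -/

open Classical in
/-- The number of elements of `s` that are at most `n`. -/
noncomputable def initialCount (s : Set ℕ) (n : ℕ) : ℤ :=
  ∑ i ∈ Finset.range (n + 1), if i ∈ s then 1 else 0

open Classical in
theorem initialCount_succ (s : Set ℕ) (n : ℕ) :
    initialCount s (n + 1) = initialCount s n + if n + 1 ∈ s then 1 else 0 :=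
  Finset.sum_range_succ _ _

theorem initialCount_zero {s : Set ℕ} (h : 0 ∉ s) : initialCount s 0 = 0 := by
  simp [initialCount, h]

theorem S₁count_eq_initialCount {x : ℝ} (hx : 0 ≤ x) :
    (S₁count x : ℤ) = initialCount S₁ ⌊x⌋₊ := by
  classical
  rw [S₁count, initialCount, Finset.sum_boole, ← Set.ncard_coe_finset]
  congr 2
  ext n
  simp only [Finset.coe_filter, Finset.mem_range, Set.mem_ofPred_eq, Nat.lt_succ_iff,
    Nat.le_floor_iff hx]
  exact and_comm

theorem initialCount_S₁ (q : ℕ) :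
    initialCount S₁ (4 * q + 1) = 2 * initialCount oddThueMorseSet q ∧
    initialCount S₁ (4 * q + 2) = 2 * initialCount oddThueMorseSet q ∧
    initialCount S₁ (4 * q + 3) = 2 * initialCount oddThueMorseSet q ∧
    initialCount S₁ (4 * q + 4) =
      initialCount oddThueMorseSet q + initialCount oddThueMorseSet (q + 1) := by
  have h2 := initialCount_succ S₁ (4 * q + 1)
  have h3 := initialCount_succ S₁ (4 * q + 2)
  have h4 := initialCount_succ S₁ (4 * q + 3)
  have hw := initialCount_succ oddThueMorseSet q
  rw [if_neg (four_mul_add_two_notMem_S₁ q)] at h2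
  rw [if_neg (four_mul_add_three_notMem_S₁ q)] at h3
  rw [show 4 * q + 3 + 1 = 4 * (q + 1) by ring, four_mul_mem_S₁] at h4
  simp only [mul_add, mul_one, add_assoc, Nat.reduceAdd] at *
  suffices h1 : initialCount S₁ (4 * q + 1) = 2 * initialCount oddThueMorseSet q by omega
  clear h2 h3 h4 hw
  induction q with
  | zero =>
    have h0 := zero_notMem_oddThueMorseSet
    have h1 := initialCount_succ S₁ 0
    have e0 := four_mul_mem_S₁ 0
    have e1 := four_mul_add_one_mem_S₁ 0
    simp only [mul_zero, zero_add] at *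
    rw [h1, initialCount_zero h0, initialCount_zero (by rwa [e0]), if_neg (by rwa [e1])]
    rfl
  | succ q ih =>
    have h2 := initialCount_succ S₁ (4 * q + 1)
    have h3 := initialCount_succ S₁ (4 * q + 2)
    have h4 := initialCount_succ S₁ (4 * q + 3)
    have h5 := initialCount_succ S₁ (4 * q + 4)
    have hw := initialCount_succ oddThueMorseSet q
    rw [if_neg (four_mul_add_two_notMem_S₁ q)] at h2
    rw [if_neg (four_mul_add_three_notMem_S₁ q)] at h3
    rw [show 4 * q + 3 + 1 = 4 * (q + 1) by ring, four_mul_mem_S₁] at h4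
    rw [show 4 * q + 4 + 1 = 4 * (q + 1) + 1 by ring, four_mul_add_one_mem_S₁] at h5
    simp only [mul_add, mul_one, add_assoc, Nat.reduceAdd] at *
    omega

/-- Six times the deviation of the counting function of `oddThueMorseSet` from `q / 6`. -/
noncomputable def countDeviation (q : ℕ) : ℤ := 6 * initialCount oddThueMorseSet q - q

theorem countDeviation_zero : countDeviation 0 = 0 := by
  simp [countDeviation, initialCount_zero zero_notMem_oddThueMorseSet]

theorem countDeviation_four_mul_add_of_four_mul (p : ℕ) :
    countDeviation (4 * p + 1) = countDeviation (4 * p) + 2 - 3 * thueMorseSign p ∧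
    countDeviation (4 * p + 2) = countDeviation (4 * p) + 1 - 3 * thueMorseSign p ∧
    countDeviation (4 * p + 3) = countDeviation (4 * p) - 3 * thueMorseSign p ∧
    countDeviation (4 * (p + 1)) =
      countDeviation (4 * p) + countDeviation (p + 1) - countDeviation p - 3 * thueMorseSign p := by
  have h1 := initialCount_succ oddThueMorseSet (4 * p)
  have h2 := initialCount_succ oddThueMorseSet (4 * p + 1)
  have h3 := initialCount_succ oddThueMorseSet (4 * p + 2)
  have h4 := initialCount_succ oddThueMorseSet (4 * p + 3)
  have h5 := initialCount_succ oddThueMorseSet p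
  have ht := thueMorseSign_eq_or p
  rw [mem_oddThueMorseSet_of_not_dvd (by omega), show (4 * p + 1) / 4 = p by omega] at h1
  rw [if_neg (by rw [mem_oddThueMorseSet_of_not_dvd (by omega)]; omega)] at h2 h3
  rw [show 4 * p + 3 + 1 = 4 * (p + 1) by ring, four_mul_mem_oddThueMorseSet] at h4
  have h1' : 2 * initialCount oddThueMorseSet (4 * p + 1) =
      2 * initialCount oddThueMorseSet (4 * p) + 1 - thueMorseSign p := by
    rcases ht with ht | ht
    · rw [h1, if_neg (by rw [ht]; norm_num), ht]; ring
    · rw [h1, if_pos ⟨by omega, ht⟩, ht]; ring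
  simp only [countDeviation]
  push_cast
  simp only [add_assoc, Nat.reduceAdd] at *
  omega

/-- R(4p) - R(p) is -3 times the sum of t(j) over j < p. The pairs t(2i) + t(2i+1) cancel; for odd p
the leftover term is t(p-1) = -t(p). -/
theorem countDeviation_four_mul (p : ℕ) :
    (p % 2 = 0 → countDeviation (4 * p) = countDeviation p) ∧
    (p % 2 = 1 → countDeviation (4 * p) = countDeviation p + 3 * thueMorseSign p) := by
  induction p with
  | zero => simp
  | succ p ih =>
    have h := (countDeviation_four_mul_add_of_four_mul p).2.2.2
    rcases Nat.even_or_odd' p with ⟨i, rfl | rfl⟩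
    · have := thueMorseSign_two_mul i
      have := thueMorseSign_two_mul_add_one i
      omega
    · omega

theorem thueMorseSign_four_mul_add (p : ℕ) :
    thueMorseSign (4 * p) = thueMorseSign p ∧ thueMorseSign (4 * p + 1) = -thueMorseSign p ∧
    thueMorseSign (4 * p + 2) = -thueMorseSign p ∧ thueMorseSign (4 * p + 3) = thueMorseSign p := by
  have h1 := thueMorseSign_two_mul p
  have h2 := thueMorseSign_two_mul_add_one p
  have h3 := thueMorseSign_two_mul (2 * p)
  have h4 := thueMorseSign_two_mul_add_one (2 * p)
  have h5 := thueMorseSign_two_mul (2 * p + 1)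
  have h6 := thueMorseSign_two_mul_add_one (2 * p + 1)
  simp only [mul_add, ← mul_assoc, Nat.reduceMul, add_assoc, Nat.reduceAdd, mul_one] at *
  omega

/-- The four constants are chosen so that the whole system is preserved when a base 4 digit is
appended; a single uniform bound would not be. -/
theorem countDeviation_lower (q : ℕ) :
    (q % 2 = 0 → thueMorseSign q = 1 → 0 ≤ countDeviation q) ∧
    (q % 2 = 0 → thueMorseSign q = -1 → -4 ≤ countDeviation q) ∧
    (q % 2 = 1 → thueMorseSign q = 1 → -3 ≤ countDeviation q) ∧
    (q % 2 = 1 → thueMorseSign q = -1 → -1 ≤ countDeviation q) := by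
  induction q using Nat.strong_induction_on with
  | _ q ih =>
    rcases Nat.eq_zero_or_pos q with rfl | hq
    · simp [countDeviation_zero, thueMorseSign_zero]
    have ih' := ih (q / 4) (by omega)
    have hL := countDeviation_four_mul (q / 4)
    have hA := countDeviation_four_mul_add_of_four_mul (q / 4)
    have hT := thueMorseSign_four_mul_add (q / 4)
    have ht := thueMorseSign_eq_or (q / 4)
    generalize hp : q / 4 = p at *
    obtain rfl | rfl | rfl | rfl : q = 4 * p ∨ q = 4 * p + 1 ∨ q = 4 * p + 2 ∨ q = 4 * p + 3 := by
      omega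
    all_goals
      clear ih hp
      rcases ht with ht | ht <;> rcases Nat.mod_two_eq_zero_or_one p with h2 | h2 <;>
      simp only [ht, h2, true_imp_iff] at * <;> omega

theorem neg_four_le_countDeviation (q : ℕ) : -4 ≤ countDeviation q := by
  have := countDeviation_lower q
  have := thueMorseSign_eq_or q
  omega

/-- An upper bound for the deviation that is stable under appending a base four digit. -/
def CountDeviationBound (c : ℤ) (q : ℕ) : Prop :=
  (q % 2 = 0 → thueMorseSign q = 1 → countDeviation q ≤ c) ∧
  (q % 2 = 0 → thueMorseSign q = -1 → countDeviation q ≤ c - 2) ∧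
  (q % 2 = 1 → thueMorseSign q = 1 → countDeviation q ≤ c) ∧
  (q % 2 = 1 → thueMorseSign q = -1 → countDeviation q ≤ c - 1)

theorem CountDeviationBound.countDeviation_le {c : ℤ} {q : ℕ} (h : CountDeviationBound c q) :
    countDeviation q ≤ c := by
  unfold CountDeviationBound at h
  have := thueMorseSign_eq_or q
  omega

theorem CountDeviationBound.of_div_four {c : ℤ} {q : ℕ} (h : CountDeviationBound c (q / 4)) :
    CountDeviationBound (c + 3) q := by
  unfold CountDeviationBound at *
  have hL := countDeviation_four_mul (q / 4)
  have hA := countDeviation_four_mul_add_of_four_mul (q / 4)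
  have hT := thueMorseSign_four_mul_add (q / 4)
  have ht := thueMorseSign_eq_or (q / 4)
  generalize hp : q / 4 = p at *
  obtain rfl | rfl | rfl | rfl : q = 4 * p ∨ q = 4 * p + 1 ∨ q = 4 * p + 2 ∨ q = 4 * p + 3 := by
    omega
  all_goals
    clear hp
    rcases ht with ht | ht <;> rcases Nat.mod_two_eq_zero_or_one p with h2 | h2 <;>
    simp only [ht, h2, true_imp_iff] at * <;> omega

theorem countDeviation_small :
    countDeviation 1 = -1 ∧ countDeviation 2 = -2 ∧ countDeviation 3 = -3 ∧
    thueMorseSign 1 = -1 ∧ thueMorseSign 2 = -1 ∧ thueMorseSign 3 = 1 := by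
  have h := countDeviation_four_mul_add_of_four_mul 0
  have hT := thueMorseSign_four_mul_add 0
  simp only [mul_zero, zero_add, thueMorseSign_zero, countDeviation_zero] at h hT
  omega

theorem countDeviationBound_of_two_le_leading (k : ℕ) :
    ∀ q, 2 * 4 ^ k ≤ q → q < 4 ^ (k + 1) → CountDeviationBound (3 * k) q := by
  induction k with
  | zero =>
    intro q h1 h2
    have := countDeviation_small
    unfold CountDeviationBound
    obtain rfl | rfl : q = 2 ∨ q = 3 := by omega
    all_goals omega
  | succ k ih =>
    intro q h1 h2
    have := (ih (q / 4) (by rw [pow_succ] at h1; omega)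
      (by rw [pow_succ] at h2; omega)).of_div_four
    convert this using 1
    push_cast
    ring

/-- Starting from the two-digit numbers 4, ..., 7 gives the constant 1, where appending a digit to q
= 1 would give 3. The gain of 2 offsets the smaller size of numbers with leading digit 1. -/
theorem countDeviationBound_of_leading_one (k : ℕ) :
    ∀ q, 4 ^ (k + 1) ≤ q → q < 2 * 4 ^ (k + 1) → CountDeviationBound (3 * k + 1) q := by
  induction k with
  | zero =>
    intro q h1 h2
    have hd := countDeviation_small
    have h := countDeviation_four_mul_add_of_four_mul 1
    have hL := (countDeviation_four_mul 1).2 rfl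
    have hT := thueMorseSign_four_mul_add 1
    unfold CountDeviationBound
    simp only [mul_one, Nat.reduceAdd] at *
    obtain rfl | rfl | rfl | rfl : q = 4 ∨ q = 5 ∨ q = 6 ∨ q = 7 := by omega
    all_goals omega
  | succ k ih =>
    intro q h1 h2
    have := (ih (q / 4) (by rw [pow_succ] at h1; omega)
      (by rw [pow_succ] at h2; omega)).of_div_four
    convert this using 1
    push_cast
    ring

/-- The worst case is n = 4q + 3 with R(q) = -4, giving 4·(-4) - 3 = -19. -/
theorem initialCount_S₁_lower (n : ℕ) : (n : ℤ) - 19 ≤ 12 * initialCount S₁ n := by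
  rcases Nat.eq_zero_or_pos n with rfl | hn
  · have h0 := (four_mul_mem_S₁ 0).not.2 zero_notMem_oddThueMorseSet
    rw [initialCount_zero h0]
    norm_num
  obtain ⟨q, hq⟩ : ∃ q, n = 4 * q + 1 ∨ n = 4 * q + 2 ∨ n = 4 * q + 3 ∨ n = 4 * q + 4 :=
    ⟨(n - 1) / 4, by omega⟩
  have h := initialCount_S₁ q
  have h1 := neg_four_le_countDeviation q
  have h2 := neg_four_le_countDeviation (q + 1)
  unfold countDeviation at h1 h2
  push_cast at h2
  obtain rfl | rfl | rfl | rfl := hq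
  all_goals push_cast; omega

/-- The alternatives are tuned to log₂ n ≥ 2k+3, > 2k+3 and ≥ 2k+4. In the second, 6(2k+3) - 19 =
12k - 1 exactly, so strictness must come from n, which is not divisible by 4 there. -/
theorem initialCount_S₁_upper {n : ℕ} (hn : 8 ≤ n) :
    ∃ k : ℕ, (8 * 4 ^ k ≤ n ∧ 12 * initialCount S₁ n - n ≤ 12 * k - 2) ∨
      (8 * 4 ^ k < n ∧ 12 * initialCount S₁ n - n ≤ 12 * k - 1) ∨
      (16 * 4 ^ k ≤ n ∧ 12 * initialCount S₁ n - n ≤ 12 * k + 3) := by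
  have hq : 2 ≤ n / 4 := by omega
  set q := n / 4 with hqdef
  have hlog1 := Nat.pow_log_le_self 4 (show q ≠ 0 by omega)
  have hlog2 := Nat.lt_pow_succ_log_self (b := 4) (by norm_num) q
  generalize Nat.log 4 q = k at hlog1 hlog2
  -- the count at `n` in terms of the deviations at `q` and `q - 1`
  have hR : (n % 4 ≠ 0 ∧ 12 * initialCount S₁ n - n ≤ 4 * countDeviation q - 1) ∨
      (n % 4 = 0 ∧
        12 * initialCount S₁ n - n ≤ 2 * countDeviation q + 2 * countDeviation (q - 1) - 2) := by
    unfold countDeviation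
    by_cases hn4 : n % 4 = 0
    · have h := initialCount_S₁ (q - 1)
      rw [show 4 * (q - 1) + 4 = n by omega, show q - 1 + 1 = q by omega] at h
      refine Or.inr ⟨hn4, ?_⟩
      push_cast [show 1 ≤ q by omega]
      omega
    · have h := initialCount_S₁ q
      refine Or.inl ⟨hn4, ?_⟩
      obtain e | e | e : n = 4 * q + 1 ∨ n = 4 * q + 2 ∨ n = 4 * q + 3 := by omega
      all_goals rw [e]; push_cast; omega
  by_cases hlead : 2 * 4 ^ k ≤ q
  · have hB := (countDeviationBound_of_two_le_leading k q hlead hlog2).countDeviation_le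
    refine ⟨k, ?_⟩
    rcases hR with ⟨h4, hR⟩ | ⟨h4, hR⟩
    · exact Or.inr (Or.inl ⟨by omega, by omega⟩)
    · refine Or.inl ⟨by omega, ?_⟩
      suffices countDeviation (q - 1) ≤ 3 * k by omega
      -- The leading digit of `q - 1` drops to 1 only at q = 2·4^k, where the bound for leading
      -- digit 1 is stronger still.
      by_cases hlead' : 2 * 4 ^ k ≤ q - 1
      · exact (countDeviationBound_of_two_le_leading k (q - 1) hlead' (by omega)).countDeviation_le
      · rcases k with _ | k
        · rw [show q - 1 = 1 by omega, countDeviation_small.1]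
          norm_num
        · have := (countDeviationBound_of_leading_one k (q - 1) (by
            have : 0 < 4 ^ (k + 1) := by positivity
            omega) (by omega)).countDeviation_le
          push_cast
          omega
  · rcases k with _ | k
    · omega
    have hB := (countDeviationBound_of_leading_one k q hlog1 (by omega)).countDeviation_le
    have hpow : 4 ^ (k + 1) = 4 * 4 ^ k := pow_succ' 4 k
    refine ⟨k, Or.inr (Or.inr ⟨by omega, ?_⟩)⟩
    rcases hR with ⟨h4, hR⟩ | ⟨h4, hR⟩
    · omega
    · suffices countDeviation (q - 1) ≤ 3 * k + 1 by omega
      by_cases hlead' : 4 ^ (k + 1) ≤ q - 1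
      · exact (countDeviationBound_of_leading_one k (q - 1) hlead' (by omega)).countDeviation_le
      · have := (countDeviationBound_of_two_le_leading k (q - 1) (by
          have : 0 < 4 ^ k := by positivity
          omega) (by omega)).countDeviation_le
        omega

/-! ### Real bounds and the density. -/

theorem natCast_le_logb_two {a n : ℕ} (h : 2 ^ a ≤ n) : (a : ℝ) ≤ Real.logb 2 n := by
  have h' : (2 : ℝ) ^ a ≤ n := by exact_mod_cast h
  rw [Real.le_logb_iff_rpow_le (by norm_num) (lt_of_lt_of_le (by positivity) h')]
  simpa using h'

theorem natCast_lt_logb_two {a n : ℕ} (h : 2 ^ a < n) : (a : ℝ) < Real.logb 2 n := by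
  have h' : (2 : ℝ) ^ a < n := by exact_mod_cast h
  rw [Real.lt_logb_iff_rpow_lt (by norm_num) (lt_of_le_of_lt (by positivity) h')]
  simpa using h'

theorem initialCount_S₁_lt_logb {n : ℕ} (hn : 6 ≤ n) :
    (12 * initialCount S₁ n - n : ℝ) < 6 * Real.logb 2 n - 19 := by
  by_cases h8 : 8 ≤ n
  · obtain ⟨k, ⟨h1, h2⟩ | ⟨h1, h2⟩ | ⟨h1, h2⟩⟩ := initialCount_S₁_upper h8
    · have := natCast_le_logb_two (a := 2 * k + 3) (n := n) (by
        rw [pow_add, pow_mul]; norm_num; omega)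
      have h2' : (12 * initialCount S₁ n - n : ℝ) ≤ 12 * k - 2 := by exact_mod_cast h2
      push_cast at this
      linarith
    · have := natCast_lt_logb_two (a := 2 * k + 3) (n := n) (by
        rw [pow_add, pow_mul]; norm_num; omega)
      have h2' : (12 * initialCount S₁ n - n : ℝ) ≤ 12 * k - 1 := by exact_mod_cast h2
      push_cast at this
      linarith
    · have := natCast_le_logb_two (a := 2 * k + 4) (n := n) (by
        rw [pow_add, pow_mul]; norm_num; omega)
      have h2' : (12 * initialCount S₁ n - n : ℝ) ≤ 12 * k + 3 := by exact_mod_cast h2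
      push_cast at this
      linarith
  · have h := initialCount_S₁ 1
    have hc := countDeviation_small.1
    unfold countDeviation at hc
    have h0 : initialCount S₁ n = 0 := by
      obtain rfl | rfl : n = 6 ∨ n = 7 := by omega
      all_goals simp only [mul_one, Nat.reduceAdd] at h; omega
    -- For n = 6, 7 the count is 0 and 6·log₂ n > 19 - n is needed; 6⁶ > 2¹³ suffices.
    have hlog := natCast_lt_logb_two (a := 13) (n := n ^ 6) (by
      refine lt_of_lt_of_le ?_ (Nat.pow_le_pow_left hn 6); norm_num)
    rw [Nat.cast_pow, Real.logb_pow] at hlog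
    have hn' : (6 : ℝ) ≤ n := by exact_mod_cast hn
    push_cast at hlog
    rw [h0]
    push_cast
    linarith

theorem S₁count_bounds {x : ℝ} (hx : 6 ≤ x) :
    -(5 / 3 : ℝ) < (S₁count x : ℝ) - x / 12 ∧
      (S₁count x : ℝ) - x / 12 < (1 / 2 : ℝ) * Real.logb 2 x - 19 / 12 := by
  have hx0 : 0 ≤ x := by linarith
  have hcount : (S₁count x : ℝ) = initialCount S₁ ⌊x⌋₊ := by
    exact_mod_cast S₁count_eq_initialCount hx0
  have hfloor := Nat.floor_le hx0
  have hfloor' := Nat.lt_floor_add_one x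
  have h6 : 6 ≤ ⌊x⌋₊ := Nat.le_floor (by exact_mod_cast hx)
  have hlow : ((⌊x⌋₊ : ℝ) - 19 : ℝ) ≤ 12 * initialCount S₁ ⌊x⌋₊ := by
    exact_mod_cast initialCount_S₁_lower ⌊x⌋₊
  have hup := initialCount_S₁_lt_logb h6
  have hlog : Real.logb 2 (⌊x⌋₊ : ℝ) ≤ Real.logb 2 x :=
    Real.logb_le_logb_of_le (by norm_num) (by positivity) hfloor
  rw [hcount]
  -- In the lower bound x < ⌊x⌋ + 1 turns -19/12 into the strict -20/12 = -5/3.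
  constructor <;> linarith

theorem tendsto_S₁count_div :
    Tendsto (fun x : ℝ => (S₁count x : ℝ) / x) atTop (𝓝 (1 / 12 : ℝ)) := by
  have hlog : Tendsto (fun x : ℝ => Real.logb 2 x / x) atTop (𝓝 0) := by
    have := (Real.isLittleO_log_id_atTop.tendsto_div_nhds_zero).div_const (Real.log 2)
    rw [zero_div] at this
    refine this.congr fun x => ?_
    simp only [Real.logb, id]
    ring
  have hinv : Tendsto (fun x : ℝ => x⁻¹) atTop (𝓝 0) := tendsto_inv_atTop_zero
  have hl : Tendsto (fun x : ℝ => 1 / 12 + -(5 / 3) * x⁻¹) atTop (𝓝 (1 / 12 : ℝ)) := by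
    simpa using (hinv.const_mul (-(5 / 3 : ℝ))).const_add (1 / 12 : ℝ)
  have hu : Tendsto (fun x : ℝ => 1 / 12 + 1 / 2 * (Real.logb 2 x / x)) atTop
      (𝓝 (1 / 12 : ℝ)) := by
    simpa using (hlog.const_mul (1 / 2 : ℝ)).const_add (1 / 12 : ℝ)
  refine tendsto_of_tendsto_of_tendsto_of_le_of_le' hl hu ?_ ?_
  · filter_upwards [eventually_ge_atTop 6] with x hx
    have hpos : 0 < x := by linarith
    rw [le_div_iff₀ hpos]
    have := (S₁count_bounds hx).1
    field_simp
    linarith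
  · filter_upwards [eventually_ge_atTop 6] with x hx
    have hpos : 0 < x := by linarith
    rw [div_le_iff₀ hpos]
    have := (S₁count_bounds hx).2
    field_simp
    linarith

/-! ### Sharpness of the logarithmic term. -/

/-- A sequence along which the deviation `countDeviation` is as large as possible. -/
def extremalSequence : ℕ → ℕ
  | 0 => 2
  | l + 1 => 16 * extremalSequence l + 6

theorem extremalSequence_spec (l : ℕ) :
    extremalSequence l % 2 = 0 ∧ thueMorseSign (extremalSequence l) = -1 ∧
    countDeviation (extremalSequence l) = 6 * l - 2 ∧
    2 * 16 ^ l ≤ extremalSequence l ∧ extremalSequence l < 3 * 16 ^ l := by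
  induction l with
  | zero =>
    have := countDeviation_small
    simp only [extremalSequence]
    norm_num
    omega
  | succ l ih =>
    obtain ⟨h1, h2, h3, h4, h5⟩ := ih
    rw [extremalSequence]
    generalize extremalSequence l = q at *
    -- For q even of sign -1, appending the digit 1 adds 5 to the deviation and the digit 2 then
    -- adds 1, returning to an even number of sign -1.
    rw [show 16 * q + 6 = 4 * (4 * q + 1) + 2 by ring, pow_succ]
    have hL := countDeviation_four_mul q
    have hA := countDeviation_four_mul_add_of_four_mul q
    have hT := thueMorseSign_four_mul_add q
    have hL' := countDeviation_four_mul (4 * q + 1)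
    have hA' := countDeviation_four_mul_add_of_four_mul (4 * q + 1)
    have hT' := thueMorseSign_four_mul_add (4 * q + 1)
    push_cast
    refine ⟨by omega, by omega, by omega, by omega, by omega⟩

theorem exists_strictMono_isEquivalent :
    ∃ m : ℕ → ℕ, StrictMono m ∧
      IsEquivalent atTop
        (fun l : ℕ => (S₁count (m l : ℝ) : ℝ) - (m l : ℝ) / 12)
        (fun l : ℕ => (1 / 2 : ℝ) * Real.logb 2 (m l : ℝ)) := by
  refine ⟨fun l => 4 * extremalSequence l + 1, strictMono_nat_of_lt_succ fun l => ?_, ?_⟩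
  · simp only [extremalSequence]
    omega
  have hcount (l : ℕ) : (S₁count ((4 * extremalSequence l + 1 : ℕ) : ℝ) : ℝ) -
      ((4 * extremalSequence l + 1 : ℕ) : ℝ) / 12 = 2 * l - 3 / 4 := by
    have h1 := S₁count_eq_initialCount (x := ((4 * extremalSequence l + 1 : ℕ) : ℝ))
      (Nat.cast_nonneg _)
    rw [Nat.floor_natCast, (initialCount_S₁ _).1] at h1
    have h2 := (extremalSequence_spec l).2.2.1
    unfold countDeviation at h2
    have h3 : 12 * (S₁count ((4 * extremalSequence l + 1 : ℕ) : ℝ) : ℤ) -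
      ((4 * extremalSequence l + 1 : ℕ) : ℤ) = 24 * l - 9 := by
      rw [h1]; push_cast; linarith
    have h4 : 12 * (S₁count ((4 * extremalSequence l + 1 : ℕ) : ℝ) : ℝ) -
      ((4 * extremalSequence l + 1 : ℕ) : ℝ) = 24 * l - 9 := by exact_mod_cast h3
    linarith
  have hlower (l : ℕ) : (4 * l + 3 : ℝ) ≤ Real.logb 2 ((4 * extremalSequence l + 1 : ℕ) : ℝ) := by
    have := (extremalSequence_spec l).2.2.2.1
    exact_mod_cast natCast_le_logb_two (a := 4 * l + 3) (by
      rw [pow_add, pow_mul]; norm_num; omega)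
  have hupper (l : ℕ) : Real.logb 2 ((4 * extremalSequence l + 1 : ℕ) : ℝ) ≤ (4 * l + 4 : ℝ) := by
    have h := (extremalSequence_spec l).2.2.2.2
    have h' : 4 * extremalSequence l + 1 ≤ 2 ^ (4 * l + 4) := by
      rw [pow_add, pow_mul]; norm_num; omega
    rw [Real.logb_le_iff_le_rpow (by norm_num) (by positivity)]
    exact_mod_cast h'
  have hlim : Tendsto (fun l : ℕ =>
      (1 / 2 : ℝ) * Real.logb 2 ((4 * extremalSequence l + 1 : ℕ) : ℝ)) atTop atTop := by
    refine tendsto_atTop_mono (fun l => ?_) tendsto_natCast_atTop_atTop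
    have := hlower l
    have : (0 : ℝ) ≤ l := Nat.cast_nonneg l
    linarith
  have hone : (fun _ : ℕ => (1 : ℝ)) =o[atTop] (fun l : ℕ =>
      (1 / 2 : ℝ) * Real.logb 2 ((4 * extremalSequence l + 1 : ℕ) : ℝ)) :=
    (isLittleO_const_left.2 (Or.inr (tendsto_norm_atTop_atTop.comp hlim)))
  -- The left side is 2l - 3/4 and the right side lies in [2l + 3/2, 2l + 2], so their difference is
  -- bounded by 3 while the right side diverges.
  refine IsBigO.trans_isLittleO (IsBigO.of_bound 3 (Eventually.of_forall fun l => ?_)) hone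
  have h1 := hlower l
  have h2 := hupper l
  simp only [Pi.sub_apply]
  rw [hcount, Real.norm_eq_abs, norm_one, abs_le]
  constructor <;> linarith

theorem mainTheorem5 :
    (∀ x : ℝ, 6 ≤ x →
      -(5 / 3 : ℝ) < (S₁count x : ℝ) - x / 12 ∧
      (S₁count x : ℝ) - x / 12 < (1 / 2 : ℝ) * Real.logb 2 x - 19 / 12) ∧
    Tendsto (fun x : ℝ => (S₁count x : ℝ) / x) atTop (𝓝 (1 / 12 : ℝ)) ∧
    ∃ m : ℕ → ℕ, StrictMono m ∧
      IsEquivalent atTop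
        (fun l : ℕ => (S₁count (m l : ℝ) : ℝ) - (m l : ℝ) / 12)
        (fun l : ℕ => (1 / 2 : ℝ) * Real.logb 2 (m l : ℝ)) :=
  ⟨fun _ hx => S₁count_bounds hx, tendsto_S₁count_div, exists_strictMono_isEquivalent⟩
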